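/- Let $K$ be a field, $n\ge 0$, and $S=K[x_1,\ldots,x_n,y_1,\ldots,y_n]$. Let $\Delta$ be a simplicial complex on $[n]=\{1,\ldots,n\}$, that is, a collection of subsets (faces) of $[n]$ that is closed under taking subsets and contains $\emptyset$. Put $\dim F=|F|-1$ for $F\in\Delta$ and $\dim\Delta=\max\{\dim F : F\in\Delta\}$, and let $f_i$ be the number of $i$-dimensional faces of $\Delta$ (so $f_{-1}=1$). The face ideal of $\Delta$ is the ideal $$J_\Delta=\Big(\prod_{i\in F}x_i\prod_{i\in[n]\setminus F}y_i \;:\; F\in\Delta\Big)\subset S.$$ Write $\beta_j(J_\Delta)=\dim_K\operatorname{Tor}^S_j(K,J_\Delta)$ for its Betti numbers, where $K=S/(x_1,\ldots,x_n,y_1,\ldots,y_n)$. If $\Delta$ has dimension $d-1$ and $f$-vector $(f_{-1},f_0,\ldots,f_{d-1})$, then for all $j\ge 0$ $$\beta_j(J_\Delta)=\sum_{i=-1}^{d-1}\binom{i+1}{j}f_i .$$ In particular, the projective dimension of the $S$-module $J_\Delta$ is $\operatorname{projdim} J_\Delta=\dim\Delta+1$. -/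

import Mathlib

open CategoryTheory

universe u v

/-- A (finite, abstract) simplicial complex on `[n]`, in the convention of combinatorial
commutative algebra: a collection of subsets of `[n]` that is closed under taking subsets and
contains the empty face (Mathlib's `PreAbstractSimplicialComplex` leaves the empty face out).
It is not required that every `{i}` is a face. -/
structure FiniteSimplicialComplex (n : ℕ) where
  faces : Finset (Finset (Fin n))
  empty_mem : ∅ ∈ faces
  down_closed : ∀ F ∈ faces, ∀ G, G ⊆ F → G ∈ faces

namespace FiniteSimplicialComplex

variable {n : ℕ} (Δ : FiniteSimplicialComplex n)

/-- The dimension of `Δ`: the maximum of `dim F = |F| - 1` over the faces `F` of `Δ`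
(so `dim {∅} = -1`). -/
def dim : ℤ := Δ.faces.sup' ⟨∅, Δ.empty_mem⟩ fun F => (F.card : ℤ) - 1

/-- The entry `f_i` of the `f`-vector: the number of `i`-dimensional faces of `Δ`. -/
def fVec (i : ℤ) : ℕ := (Δ.faces.filter fun F => (F.card : ℤ) - 1 = i).card

/-- The monomial `u_F = ∏_{i ∈ F} x_i ∏_{i ∉ F} y_i` of `K[x_1, …, x_n, y_1, …, y_n]`, where
`x_i` is the variable `Sum.inl i` and `y_i` is the variable `Sum.inr i`. -/
noncomputable def faceMonomial (K : Type*) [Field K] (F : Finset (Fin n)) :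
    MvPolynomial (Fin n ⊕ Fin n) K :=
  (∏ i ∈ F, MvPolynomial.X (Sum.inl i)) * ∏ i ∈ Fᶜ, MvPolynomial.X (Sum.inr i)

/-- The face ideal `J_Δ`, generated by the monomials `u_F` with `F ∈ Δ`. -/
noncomputable def faceIdeal (K : Type*) [Field K] : Ideal (MvPolynomial (Fin n ⊕ Fin n) K) :=
  Ideal.span (faceMonomial K '' (Δ.faces : Set (Finset (Fin n))))

end FiniteSimplicialComplex

/-- The `j`-th Betti number `β_j(M) = dim_K Tor_j^S(K, M)` of a module `M` over the polynomial ring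
`S` over `K`, where `K = S / 𝔪` is the `S`-module on which all the variables act as zero. It is
defined as a cardinal number, so that no junk value occurs. -/
noncomputable def bettiNumber {σ : Type v} {K : Type u} [Field K]
    (M : ModuleCat.{max v u} (MvPolynomial σ K)) (j : ℕ) : Cardinal.{max v u} :=
  Module.rank K ((ModuleCat.restrictScalars (algebraMap K (MvPolynomial σ K))).obj
    (((Tor (ModuleCat.{max v u} (MvPolynomial σ K)) j).obj
      (ModuleCat.of (MvPolynomial σ K)
        (MvPolynomial σ K ⧸ Ideal.span (Set.range (MvPolynomial.X (R := K) (σ := σ)))))).obj M))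

/-! ### Functorial projective resolutions of modules -/

section

open Limits Abelian

/-! Induct on the vertex set. Splitting the faces according to whether they contain a vertex `v`
gives `L = y_v J + x_v I`, where `J` and `I` are the ideals of the deletion and of the link of `v`,
and `I ≤ J`. The relations between the two summands form one copy of `I`, so there is a short exact
sequence `0 → I → J × I → L → 0` (`Ideal.shortExact_mulAddComplex`). Its first map has the variables
`x_v` and `y_v` as coefficients. Both act as zero on the residue field, so `Tor` kills this map
(`ModuleCat.tor_map_smul`).

The long exact sequence of `Tor` therefore breaks into short exact ones, and `β_j(L) = β_j(J) +
β_j(I) + β_{j-1}(I)`. By Pascal's rule the sum of `F.card.choose j` over the faces obeys the same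
recursion. The same sequence bounds the projective dimension from above, and a face of maximal size
makes the top Betti number nonzero, which bounds it from below.

The long exact sequence comes from a horseshoe: iterated free covers are functorial and turn
monomorphisms into degreewise split ones, so the cokernel of the induced map of resolutions is again
a projective resolution. -/

lemma CategoryTheory.Limits.mono_kernel_map {C : Type*} [Category C] [HasZeroMorphisms C]
    {X Y X' Y' : C} (f : X ⟶ Y) [HasKernel f] (f' : X' ⟶ Y') [HasKernel f'] (p : X ⟶ X')
    (q : Y ⟶ Y') (w : f ≫ q = p ≫ f') [Mono p] : Mono (kernel.map f f' p q w) := by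
  have : Mono (kernel.map f f' p q w ≫ kernel.ι f') := by
    rw [kernel.lift_ι]; infer_instance
  exact mono_of_mono _ (kernel.ι f')

namespace CategoryTheory.Abelian.LeftResolution

variable {A C : Type*} [Category A] [Category C] [Abelian A] [Preadditive C] {ι : C ⥤ A}
  [ι.Full] [ι.Faithful] (Λ : LeftResolution ι)

/-- Each term of the resolution past the first is the cover of a kernel, and a monomorphism of maps
induces a monomorphism of kernels, so the hypothesis on covers propagates through all degrees. -/
lemma isSplitMono_map_chainComplexMap_f
    (h : ∀ {X Y : A} (f : X ⟶ Y) [Mono f], IsSplitMono (ι.map (Λ.F.map f)))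
    {X Y : A} (f : X ⟶ Y) [Mono f] (n : ℕ) :
    IsSplitMono (ι.map ((Λ.chainComplexMap f).f n)) := by
  have := h f
  induction n with
  | zero =>
    rw [chainComplexMap_f_0, Functor.map_comp, Functor.map_comp]
    infer_instance
  | succ n ih =>
    obtain _ | n := n
    · rw [chainComplexMap_f_1, Functor.map_comp, Functor.map_comp]
      have h1 : Mono (kernel.map _ _ (ι.map (Λ.F.map f)) f (Λ.π.naturality f).symm) := by
        apply +allowSynthFailures mono_kernel_map
      have := h (kernel.map _ _ (ι.map (Λ.F.map f)) f (Λ.π.naturality f).symm)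
      infer_instance
    · rw [chainComplexMap_f_succ_succ, Functor.map_comp, Functor.map_comp]
      have hw : ι.map ((Λ.chainComplex X).d (n + 1) n) ≫ ι.map ((Λ.chainComplexMap f).f n) =
          ι.map ((Λ.chainComplexMap f).f (n + 1)) ≫ ι.map ((Λ.chainComplex Y).d (n + 1) n) := by
        rw [← ι.map_comp, ← ι.map_comp, HomologicalComplex.Hom.comm]
      have := mono_kernel_map _ _ _ _ hw
      have := h (kernel.map _ _ _ _ hw)
      infer_instance

variable [ι.Additive]

/-- The augmentation in degree zero of the resolution of `X`. -/
noncomputable def augZero (X : A) :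
    ((ι.mapHomologicalComplex _).obj (Λ.chainComplex X)).X 0 ⟶ X :=
  ι.map (Λ.chainComplexXZeroIso X).hom ≫ Λ.π.app X

instance (X : A) : Epi (Λ.augZero X) := epi_comp (ι.map _) (Λ.π.app X)

lemma d_comp_augZero (X : A) :
    ((ι.mapHomologicalComplex _).obj (Λ.chainComplex X)).d 1 0 ≫ Λ.augZero X = 0 := by
  change ι.map _ ≫ ι.map _ ≫ _ = 0
  rw [map_chainComplex_d_1_0]
  simp only [Category.assoc]
  rw [← Functor.map_comp_assoc, Iso.inv_hom_id]
  simp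

/-- Up to isomorphism the first differential is the cover of `kernel (Λ.π.app X)` followed by the
kernel inclusion, so it maps onto that kernel. -/
lemma exact_augZero (X : A) : (ShortComplex.mk _ _ (Λ.d_comp_augZero X)).Exact := by
  let S : ShortComplex A :=
    ShortComplex.mk (Λ.π.app (kernel (Λ.π.app X)) ≫ kernel.ι _) (Λ.π.app X) (by simp)
  let e : S ≅ ShortComplex.mk _ _ (Λ.d_comp_augZero X) :=
    ShortComplex.isoMk (ι.mapIso (Λ.chainComplexXOneIso X).symm)
      (ι.mapIso (Λ.chainComplexXZeroIso X).symm) (Iso.refl _)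
      (by
        change ι.map _ ≫ ι.map _ = _ ≫ ι.map _
        rw [map_chainComplex_d_1_0, ← Functor.map_comp_assoc, Iso.symm_hom, Iso.inv_hom_id]
        simp [S])
      (by
        change ι.map _ ≫ ι.map _ ≫ _ = _ ≫ 𝟙 _
        rw [← Functor.map_comp_assoc, Iso.symm_hom, Iso.inv_hom_id]
        simp [S])
  rw [← ShortComplex.exact_iff_of_iso e]
  rw [ShortComplex.exact_iff_epi_kernel_lift]
  have h : kernel.lift S.g S.f S.zero = Λ.π.app (kernel (Λ.π.app X)) := by
    rw [← cancel_mono (kernel.ι _), kernel.lift_ι]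
  rw [h]
  infer_instance

/-- The augmentation of the resolution of `X`. -/
noncomputable def aug (X : A) :
    (ι.mapHomologicalComplex _).obj (Λ.chainComplex X) ⟶ (ChainComplex.single₀ A).obj X :=
  (ChainComplex.toSingle₀Equiv _ _).symm ⟨Λ.augZero X, Λ.d_comp_augZero X⟩

@[simp] lemma aug_f_zero (X : A) : (Λ.aug X).f 0 = Λ.augZero X :=
  ChainComplex.toSingle₀Equiv_symm_apply_f_zero _ _

lemma augZero_naturality {X Y : A} (f : X ⟶ Y) :
    ((ι.mapHomologicalComplex _).map (Λ.chainComplexMap f)).f 0 ≫ Λ.augZero Y =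
      Λ.augZero X ≫ f := by
  change ι.map _ ≫ ι.map _ ≫ _ = (ι.map _ ≫ _) ≫ _
  rw [chainComplexMap_f_0]
  simp only [Functor.map_comp, Category.assoc]
  rw [← Functor.map_comp_assoc ι (Λ.chainComplexXZeroIso Y).inv, Iso.inv_hom_id]
  simp

lemma aug_naturality {X Y : A} (f : X ⟶ Y) :
    (ι.mapHomologicalComplex _).map (Λ.chainComplexMap f) ≫ Λ.aug Y =
      Λ.aug X ≫ (ChainComplex.single₀ A).map f := by
  apply HomologicalComplex.to_single_hom_ext
  rw [HomologicalComplex.comp_f, HomologicalComplex.comp_f, aug_f_zero, aug_f_zero]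
  erw [ChainComplex.single₀_map_f_zero]
  exact Λ.augZero_naturality f

instance (X : A) : QuasiIso (Λ.aug X) :=
  ⟨fun n => by
    cases n
    · rw [ChainComplex.quasiIsoAt₀_iff, ShortComplex.quasiIso_iff_of_zeros']
      · refine (ShortComplex.exact_and_epi_g_iff_of_iso ?_).2
          ⟨Λ.exact_augZero X, inferInstanceAs (Epi (Λ.augZero X))⟩
        exact ShortComplex.isoMk (Iso.refl _) (Iso.refl _) (Iso.refl _)
          ((Category.id_comp _).trans (Category.comp_id _).symm)
          ((Category.id_comp _).trans (((Category.comp_id _).trans (Λ.aug_f_zero X)).symm))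
      · exact HomologicalComplex.shape ((ι.mapHomologicalComplex _).obj (Λ.chainComplex X)) 0 0
          (by simp)
      · rfl
      · rfl
    · rw [quasiIsoAt_iff_exactAt']
      · exact Λ.exactAt_map_chainComplex_succ X _
      · apply ChainComplex.exactAt_succ_single_obj⟩

end CategoryTheory.Abelian.LeftResolution

namespace ModuleCat

variable {R : Type u} [Ring R]

/-- An injection of sets has a retraction as soon as its source is nonempty. For modules, the
element `0` ensures this. -/
lemma free_map_isSplitMono {X Y : Type u} [Nonempty X] (f : X ⟶ Y) [Mono f] :
    IsSplitMono ((free R).map f) := by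
  obtain ⟨g, hg⟩ := ((CategoryTheory.mono_iff_injective f).1 inferInstance).hasLeftInverse
  have : IsSplitMono f := ⟨⟨⟨↾g, by ext x; exact hg x⟩⟩⟩
  infer_instance

lemma projectiveResolution_map_isSplitMono {X Y : ModuleCat.{u} R} (f : X ⟶ Y) [Mono f] :
    IsSplitMono ((ObjectProperty.ι (isProjective (ModuleCat.{u} R))).map
      ((projectiveResolution R).F.map f)) := by
  have : Nonempty ((forget (ModuleCat.{u} R)).obj X) := ⟨(0 : X)⟩
  exact free_map_isSplitMono ((forget (ModuleCat.{u} R)).map f)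

end ModuleCat

end

/-! ### The horseshoe and the long exact sequence of left derived functors -/

section

open Limits Abelian

namespace CategoryTheory

lemma ShortComplex.epi_g_of_iso {D : Type*} [Category D] [Abelian D] {S T : ShortComplex D}
    (α : S ≅ T) [Epi T.g] : Epi S.g := by
  have h : S.g = α.hom.τ₂ ≫ T.g ≫ α.inv.τ₃ := by
    rw [α.hom.comm₂₃_assoc, ← ShortComplex.comp_τ₃, α.hom_inv_id, ShortComplex.id_τ₃,
      Category.comp_id]
  rw [h]
  infer_instance

lemma ShortComplex.exists_connecting_of_iso {D : Type*} [Category D] [Abelian D]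
    {S S' T T' : ShortComplex D} (α : S ≅ T) (β : S' ≅ T') (d : T.X₃ ⟶ T'.X₁)
    (w : T.g ≫ d = 0) (w' : d ≫ T'.f = 0) (h : (ShortComplex.mk _ _ w).Exact)
    (h' : (ShortComplex.mk _ _ w').Exact) :
    ∃ (δ : S.X₃ ⟶ S'.X₁) (w : S.g ≫ δ = 0) (w' : δ ≫ S'.f = 0),
      (ShortComplex.mk _ _ w).Exact ∧ (ShortComplex.mk _ _ w').Exact := by
  have e₁ : S.g ≫ α.hom.τ₃ ≫ d ≫ β.inv.τ₁ = 0 := by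
    rw [← α.hom.comm₂₃_assoc, reassoc_of% w, zero_comp, comp_zero]
  have e₂ : (α.hom.τ₃ ≫ d ≫ β.inv.τ₁) ≫ S'.f = 0 := by
    rw [Category.assoc, Category.assoc, β.inv.comm₁₂, reassoc_of% w', zero_comp, comp_zero]
  refine ⟨α.hom.τ₃ ≫ d ≫ β.inv.τ₁, e₁, e₂, ?_, ?_⟩
  · refine (ShortComplex.exact_iff_of_iso (ShortComplex.isoMk (asIso α.hom.τ₂) (asIso α.hom.τ₃)
      (asIso β.hom.τ₁) (by simp [α.hom.comm₂₃]) ?_)).2 h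
    simp [← ShortComplex.comp_τ₁]
  · refine (ShortComplex.exact_iff_of_iso (ShortComplex.isoMk (asIso α.hom.τ₃) (asIso β.hom.τ₁)
      (asIso β.hom.τ₂) ?_ (by simp [β.hom.comm₁₂]))).2 h'
    simp [← ShortComplex.comp_τ₁]

/-- A horseshoe for a short complex `S`: projective resolutions of its three objects which form a
degreewise split short complex lying over `S`. -/
structure Horseshoe {A : Type*} [Category A] [Abelian A] (S : ShortComplex A) where
  P₁ : ProjectiveResolution S.X₁
  P₂ : ProjectiveResolution S.X₂
  P₃ : ProjectiveResolution S.X₃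
  f : P₁.complex ⟶ P₂.complex
  g : P₂.complex ⟶ P₃.complex
  zero : f ≫ g = 0
  split (n : ℕ) : ((ShortComplex.mk f g zero).map (HomologicalComplex.eval A _ n)).Splitting
  comm_f : f.f 0 ≫ P₂.π.f 0 = P₁.π.f 0 ≫ S.f
  comm_g : g.f 0 ≫ P₃.π.f 0 = P₂.π.f 0 ≫ S.g

/-- A degreewise split monomorphism between projective resolutions extends to a horseshoe. -/
theorem exists_horseshoe_of_isSplitMono {A : Type*} [Category A] [Abelian A] {S : ShortComplex A}
    (hS : S.ShortExact) (P₁ : ProjectiveResolution S.X₁) (P₂ : ProjectiveResolution S.X₂)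
    (f : P₁.complex ⟶ P₂.complex) (hf : ∀ n, IsSplitMono (f.f n))
    (comm : f ≫ P₂.π = P₁.π ≫ (ChainComplex.single₀ A).map S.f) : Nonempty (Horseshoe S) := by
  have : Mono f := HomologicalComplex.mono_of_mono_f _ fun n => inferInstance
  let T : ShortComplex (ChainComplex A ℕ) := ShortComplex.mk f (cokernel.π f) (by simp)
  have hT : T.ShortExact :=
    ShortComplex.ShortExact.mk' (ShortComplex.exact_cokernel f) inferInstance inferInstance
  have hTn (n : ℕ) : (T.map (HomologicalComplex.eval A _ n)).ShortExact :=
    hT.map_of_exact _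
  let s (n : ℕ) : (T.map (HomologicalComplex.eval A _ n)).Splitting :=
    ShortComplex.Splitting.ofExactOfRetraction _ (hTn n).exact
      (@retraction _ _ _ _ (f.f n) (hf n)) (@IsSplitMono.id _ _ _ _ (f.f n) (hf n)) (hTn n).epi_g
  let q : cokernel f ⟶ (ChainComplex.single₀ A).obj S.X₃ :=
    cokernel.desc f (P₂.π ≫ (ChainComplex.single₀ A).map S.g) (by
      rw [← Category.assoc, comm, Category.assoc, ← Functor.map_comp, S.zero, Functor.map_zero,
        comp_zero])
  have hq : cokernel.π f ≫ q = P₂.π ≫ (ChainComplex.single₀ A).map S.g :=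
    cokernel.π_desc _ _ _
  let φ : T ⟶ S.map (ChainComplex.single₀ A) :=
    { τ₁ := P₁.π
      τ₂ := P₂.π
      τ₃ := q
      comm₁₂ := comm.symm
      comm₂₃ := hq.symm }
  have hS' : (S.map (ChainComplex.single₀ A)).ShortExact :=
    hS.map_of_exact (HomologicalComplex.single A (ComplexShape.down ℕ) 0)
  -- Compare the long exact homology sequences of `T` and of `S` placed in degree zero: two of the
  -- three vertical maps are quasi-isomorphisms, hence so is the third.
  have : QuasiIso q := HomologicalComplex.HomologySequence.quasiIso_τ₃ φ hT hS'
    (inferInstanceAs (QuasiIso P₁.π)) (inferInstanceAs (QuasiIso P₂.π))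
  -- The degreewise splitting makes each term of the cokernel a retract of a projective.
  have hproj (n : ℕ) : Projective ((cokernel f).X n) :=
    Retract.projective (Y := P₂.complex.X n) ⟨(s n).s, (cokernel.π f).f n, (s n).s_g⟩
  exact ⟨{
    P₁ := P₁
    P₂ := P₂
    P₃ := { complex := cokernel f
            π := q }
    f := f
    g := cokernel.π f
    zero := by simp
    split := s
    comm_f := by
      rw [← HomologicalComplex.comp_f, comm, HomologicalComplex.comp_f,
        ChainComplex.single₀_map_f_zero]
      rfl
    comm_g := by
      rw [← HomologicalComplex.comp_f, hq, HomologicalComplex.comp_f,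
        ChainComplex.single₀_map_f_zero]
      rfl }⟩

namespace Abelian.LeftResolution

variable {A C : Type*} [Category A] [Category C] [Abelian A] [Preadditive C] {ι : C ⥤ A}
  [ι.Full] [ι.Faithful] [ι.Additive] (Λ : LeftResolution ι)

/-- The resolution of `X` given by a left resolution by projective objects. -/
noncomputable def toProjectiveResolution (hP : ∀ Y, Projective (ι.obj Y)) (X : A) :
    ProjectiveResolution X where
  complex := (ι.mapHomologicalComplex _).obj (Λ.chainComplex X)
  projective n := hP _
  π := Λ.aug X

lemma exists_horseshoe (hP : ∀ Y, Projective (ι.obj Y))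
    (h : ∀ {X Y : A} (f : X ⟶ Y) [Mono f], IsSplitMono (ι.map (Λ.F.map f)))
    {S : ShortComplex A} (hS : S.ShortExact) : Nonempty (Horseshoe S) := by
  have := hS.mono_f
  exact exists_horseshoe_of_isSplitMono hS (Λ.toProjectiveResolution hP S.X₁)
    (Λ.toProjectiveResolution hP S.X₂) ((ι.mapHomologicalComplex _).map (Λ.chainComplexMap S.f))
    (fun n => Λ.isSplitMono_map_chainComplexMap_f h S.f n) (Λ.aug_naturality S.f)

end Abelian.LeftResolution

theorem _root_.ModuleCat.exists_horseshoe {R : Type u} [Ring R] {S : ShortComplex (ModuleCat.{u} R)}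
    (hS : S.ShortExact) : Nonempty (Horseshoe S) :=
  (ModuleCat.projectiveResolution R).exists_horseshoe (fun Y => Y.property)
    (fun f _ => ModuleCat.projectiveResolution_map_isSplitMono f) hS

/-- The sum of lifts of `f` and `g` to resolutions is a lift of `f + g`. -/
instance {A D : Type*} [Category A] [Category D] [Abelian A] [Abelian D]
    [HasProjectiveResolutions A] (F : A ⥤ D) [F.Additive] (n : ℕ) : (F.leftDerived n).Additive where
  map_add {X Y f g} := by
    let P := projectiveResolution X
    let Q := projectiveResolution Y
    rw [F.leftDerived_map_eq n f (ProjectiveResolution.lift f P Q) (by simp),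
      F.leftDerived_map_eq n g (ProjectiveResolution.lift g P Q) (by simp),
      F.leftDerived_map_eq n (f + g) (ProjectiveResolution.lift f P Q +
        ProjectiveResolution.lift g P Q) (by simp [Functor.map_add])]
    rw [Functor.map_add, Preadditive.add_comp, Preadditive.comp_add]

namespace Horseshoe

variable {A D : Type*} [Category A] [Category D] [Abelian A] [Abelian D] {S : ShortComplex A}
  (H : Horseshoe S) (F : A ⥤ D) [F.Additive]

/-- The short complex of complexes obtained by applying an additive functor to a horseshoe. -/
noncomputable abbrev mapComplex : ShortComplex (ChainComplex D ℕ) :=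
  (ShortComplex.mk H.f H.g H.zero).map (F.mapHomologicalComplex _)

lemma shortExact_mapComplex : (H.mapComplex F).ShortExact :=
  HomologicalComplex.shortExact_of_degreewise_shortExact _ fun n =>
    ((H.split n).map F).shortExact

variable [HasProjectiveResolutions A]

/-- The left derived functors applied to `S` are the homology of `H.mapComplex F`. -/
noncomputable def leftDerivedIso (n : ℕ) : S.map (F.leftDerived n) ≅
    (H.mapComplex F).map (HomologicalComplex.homologyFunctor D _ n) :=
  ShortComplex.isoMk (H.P₁.isoLeftDerivedObj F n) (H.P₂.isoLeftDerivedObj F n)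
    (H.P₃.isoLeftDerivedObj F n)
    (ProjectiveResolution.isoLeftDerivedObj_hom_naturality S.f H.P₁ H.P₂ H.f H.comm_f F n).symm
    (ProjectiveResolution.isoLeftDerivedObj_hom_naturality S.g H.P₂ H.P₃ H.g H.comm_g F n).symm

include H in
lemma leftDerived_exact₂ (n : ℕ) : (S.map (F.leftDerived n)).Exact :=
  (ShortComplex.exact_iff_of_iso (H.leftDerivedIso F n)).2
    ((H.shortExact_mapComplex F).homology_exact₂ n)

include H in
/-- The long exact sequence of left derived functors. -/
theorem exists_leftDerived_δ (n : ℕ) :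
    ∃ (δ : (F.leftDerived (n + 1)).obj S.X₃ ⟶ (F.leftDerived n).obj S.X₁)
      (w : (F.leftDerived (n + 1)).map S.g ≫ δ = 0) (w' : δ ≫ (F.leftDerived n).map S.f = 0),
      (ShortComplex.mk _ _ w).Exact ∧ (ShortComplex.mk _ _ w').Exact :=
  ShortComplex.exists_connecting_of_iso (H.leftDerivedIso F (n + 1)) (H.leftDerivedIso F n) _
    _ _ ((H.shortExact_mapComplex F).homology_exact₃ (n + 1) n (by simp))
    ((H.shortExact_mapComplex F).homology_exact₁ (n + 1) n (by simp))

include H in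
lemma leftDerived_zero_epi : Epi ((F.leftDerived 0).map S.g) := by
  have : Epi (H.mapComplex F).g := (H.shortExact_mapComplex F).epi_g
  have : Epi ((H.mapComplex F).map (HomologicalComplex.homologyFunctor D _ 0)).g :=
    HomologicalComplex.epi_homologyMap_of_epi_of_not_rel _ _ (by simp)
  exact ShortComplex.epi_g_of_iso (H.leftDerivedIso F 0)

end Horseshoe

end CategoryTheory

end

/-! ### Vanishing of derived functors, and scalars acting on `Tor` -/

section

open Limits Abelian

namespace CategoryTheory

/-- On projective objects, the zeroth left derived functor of `F` agrees with `F`. -/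
noncomputable def Functor.leftDerivedZeroIsoOfProjective {A D : Type*} [Category A] [Category D]
    [Abelian A] [Abelian D] [HasProjectiveResolutions A] (F : A ⥤ D) [F.Additive] (X : A)
    [Projective X] : (F.leftDerived 0).obj X ≅ F.obj X :=
  asIso (F.fromLeftDerivedZero.app X)

/-- Dimension shifting: the kernel of a projective cover map has projective dimension smaller by
one, and the long exact sequence traps the derived functor of `X` between two zero objects. -/
theorem isZero_leftDerived_of_hasProjectiveDimensionLT {R : Type u} [Ring R] {D : Type*}
    [Category D] [Abelian D] (F : ModuleCat.{u} R ⥤ D) [F.Additive] (n : ℕ) (X : ModuleCat.{u} R)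
    [hX : HasProjectiveDimensionLT X n] : IsZero ((F.leftDerived n).obj X) := by
  induction n generalizing X with
  | zero => exact (F.leftDerived 0).map_isZero (isZero_of_hasProjectiveDimensionLT_zero X)
  | succ n ih =>
    obtain _ | n := n
    · have : Projective X := projective_iff_hasProjectiveDimensionLT_one.2 hX
      exact F.isZero_leftDerived_obj_projective_succ 0 X
    let S : ShortComplex (ModuleCat.{u} R) :=
      ShortComplex.mk (kernel.ι (Projective.π X)) (Projective.π X) (by simp)
    have hS : S.ShortExact := ShortComplex.ShortExact.mk'
      (ShortComplex.exact_of_f_is_kernel _ (kernelIsKernel _))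
      (inferInstanceAs (Mono (kernel.ι _))) (inferInstanceAs (Epi (Projective.π X)))
    have hP : Projective S.X₂ := inferInstanceAs (Projective (Projective.over X))
    have : HasProjectiveDimensionLT S.X₁ (n + 1) :=
      (hS.hasProjectiveDimensionLT_X₃_iff n hP).1 hX
    obtain ⟨H⟩ := ModuleCat.exists_horseshoe hS
    obtain ⟨δ, w, w', h, -⟩ := H.exists_leftDerived_δ F (n + 1)
    have h₂ : IsZero ((F.leftDerived (n + 1 + 1)).obj S.X₂) :=
      F.isZero_leftDerived_obj_projective_succ (n + 1) S.X₂
    exact h.isZero_of_both_zeros (h₂.eq_of_src _ _) ((ih S.X₁).eq_of_tgt _ _)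

section Tor

variable {R : Type u} [CommRing R]

open MonoidalCategory

/-- The scalar moves across the tensor product and acts on `k`, where it is zero. -/
lemma ModuleCat.tensoringLeft_map_smul {k : ModuleCat.{u} R} {r : R} (hr : ∀ x : k, r • x = 0)
    {X Y : ModuleCat.{u} R} (f : X ⟶ Y) :
    ((tensoringLeft (ModuleCat.{u} R)).obj k).map (r • f) = 0 := by
  have h : r • 𝟙 k = 0 := by ext x; exact hr x
  calc k ◁ (r • f) = k ◁ f ≫ ((r • 𝟙 k) ▷ Y) := by
        rw [MonoidalLinear.whiskerLeft_smul, MonoidalLinear.smul_whiskerRight]; simp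
    _ = 0 := by rw [h]; simp

lemma ModuleCat.tor_map_smul {k : ModuleCat.{u} R} {r : R} (hr : ∀ x : k, r • x = 0)
    {X Y : ModuleCat.{u} R} (f : X ⟶ Y) (n : ℕ) :
    ((Tor (ModuleCat.{u} R) n).obj k).map (r • f) = 0 := by
  rw [Tor_obj]
  -- `r` times a lift of `f` lifts `r • f`, so after tensoring with `k` the chain map is already
  -- zero.
  rw [Functor.leftDerived_map_eq _ n (r • f) (P := projectiveResolution X)
    (Q := projectiveResolution Y) (r • ProjectiveResolution.lift f _ _) (by
      rw [Linear.smul_comp, ProjectiveResolution.lift_commutes, ← Linear.comp_smul]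
      congr 1
      ext
      simp
      rfl)]
  have : (((tensoringLeft (ModuleCat.{u} R)).obj k).mapHomologicalComplex (ComplexShape.down ℕ)).map
      (r • ProjectiveResolution.lift f (projectiveResolution X) (projectiveResolution Y)) = 0 := by
    ext i : 1
    exact ModuleCat.tensoringLeft_map_smul hr _
  rw [Functor.comp_map, this, Functor.map_zero]
  exact (congrArg _ zero_comp).trans comp_zero

end Tor
end CategoryTheory

/-! ### Betti numbers along short exact sequences -/

section Betti

variable {σ : Type v} {K : Type u} [Field K]

/-- The residue field of the polynomial ring at the origin, as a module. -/
noncomputable abbrev residueModule (σ : Type v) (K : Type u) [Field K] :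
    ModuleCat.{max v u} (MvPolynomial σ K) :=
  ModuleCat.of (MvPolynomial σ K)
    (MvPolynomial σ K ⧸ Ideal.span (Set.range (MvPolynomial.X (R := K) (σ := σ))))

/-- The dimension over `K` of a module over the polynomial ring. -/
noncomputable def coeffRank (M : ModuleCat.{max v u} (MvPolynomial σ K)) : Cardinal.{max v u} :=
  Module.rank K ((ModuleCat.restrictScalars (algebraMap K (MvPolynomial σ K))).obj M)

lemma coeffRank_add {S : ShortComplex (ModuleCat.{max v u} (MvPolynomial σ K))}
    (hS : S.ShortExact) : coeffRank S.X₂ = coeffRank S.X₁ + coeffRank S.X₃ := by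
  have := hS.map_of_exact (ModuleCat.restrictScalars (algebraMap K (MvPolynomial σ K)))
  exact ModuleCat.free_shortExact_rank_add this

lemma coeffRank_eq_of_iso {M N : ModuleCat.{max v u} (MvPolynomial σ K)} (e : M ≅ N) :
    coeffRank M = coeffRank N :=
  (((ModuleCat.restrictScalars (algebraMap K (MvPolynomial σ K))).mapIso e).toLinearEquiv).rank_eq

lemma coeffRank_eq_zero {M : ModuleCat.{max v u} (MvPolynomial σ K)} (h : IsZero M) :
    coeffRank M = 0 := by
  have := ModuleCat.subsingleton_of_isZero
    ((ModuleCat.restrictScalars (algebraMap K (MvPolynomial σ K))).map_isZero h)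
  exact rank_subsingleton' _ _

lemma X_smul_residueModule (s : σ) (x : residueModule σ K) :
    (MvPolynomial.X s : MvPolynomial σ K) • x = 0 := by
  obtain ⟨p, rfl⟩ := Ideal.Quotient.mk_surjective x
  exact Ideal.Quotient.eq_zero_iff_mem.2
    (Ideal.mul_mem_right p _ (Ideal.subset_span ⟨s, rfl⟩))

lemma bettiNumber_eq_of_iso {M N : ModuleCat.{max v u} (MvPolynomial σ K)} (e : M ≅ N) (j : ℕ) :
    bettiNumber M j = bettiNumber N j :=
  coeffRank_eq_of_iso (((Tor _ j).obj _).mapIso e)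

lemma bettiNumber_eq_zero_of_hasProjectiveDimensionLT
    (M : ModuleCat.{max v u} (MvPolynomial σ K)) (j : ℕ) [HasProjectiveDimensionLT M j] :
    bettiNumber M j = 0 :=
  coeffRank_eq_zero (isZero_leftDerived_of_hasProjectiveDimensionLT _ j M)

lemma bettiNumber_add_of_splitting {S : ShortComplex (ModuleCat.{max v u} (MvPolynomial σ K))}
    (s : S.Splitting) (j : ℕ) :
    bettiNumber S.X₂ j = bettiNumber S.X₁ j + bettiNumber S.X₃ j :=
  coeffRank_add ((s.map (Functor.leftDerived
    ((MonoidalCategory.tensoringLeft _).obj (residueModule σ K)) j)).shortExact)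

section ShortExact

variable {S : ShortComplex (ModuleCat.{max v u} (MvPolynomial σ K))} (hS : S.ShortExact)
  (h : ∀ j, ((Tor _ j).obj (residueModule σ K)).map S.f = 0)

include hS h

/-- The functor `Tor_0` preserves the epimorphism `S.g`, and exactness in the middle makes its image
a monomorphism because the preceding map vanishes. -/
lemma bettiNumber_zero_of_tor_map_eq_zero : bettiNumber S.X₃ 0 = bettiNumber S.X₂ 0 := by
  obtain ⟨H⟩ := ModuleCat.exists_horseshoe hS
  let F := (MonoidalCategory.tensoringLeft _).obj (residueModule σ K)
  have h₁ := H.leftDerived_zero_epi F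
  have h₂ := (H.leftDerived_exact₂ F 0).mono_g (h 0)
  have : IsIso ((F.leftDerived 0).map S.g) := @isIso_of_mono_of_epi _ _ _ _ _ _ h₂ h₁
  exact (coeffRank_eq_of_iso (asIso ((F.leftDerived 0).map S.g))).symm

/-- The vanishing maps on either side cut `0 → Tor_{j+1}(X₂) → Tor_{j+1}(X₃) → Tor_j(X₁) → 0` out of
the long exact sequence. -/
lemma bettiNumber_succ_of_tor_map_eq_zero (j : ℕ) :
    bettiNumber S.X₃ (j + 1) = bettiNumber S.X₂ (j + 1) + bettiNumber S.X₁ j := by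
  obtain ⟨H⟩ := ModuleCat.exists_horseshoe hS
  let F := (MonoidalCategory.tensoringLeft _).obj (residueModule σ K)
  obtain ⟨δ, w, w', e, e'⟩ := H.exists_leftDerived_δ F j
  exact coeffRank_add (ShortComplex.ShortExact.mk' e
    ((H.leftDerived_exact₂ F (j + 1)).mono_g (h (j + 1))) (e'.epi_f (h j)))

end ShortExact

lemma sub_C_constantCoeff_mem (p : MvPolynomial σ K) :
    p - MvPolynomial.C (MvPolynomial.constantCoeff p) ∈
      Ideal.span (Set.range (MvPolynomial.X (R := K) (σ := σ))) := by
  induction p using MvPolynomial.induction_on with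
  | C a => simp
  | add p q hp hq =>
    rw [map_add, map_add, add_sub_add_comm]
    exact add_mem hp hq
  | mul_X p i _ =>
    simpa using Ideal.mul_mem_left _ p (Ideal.subset_span (Set.mem_range_self i))

lemma one_notMem_span_range_X :
    (1 : MvPolynomial σ K) ∉ Ideal.span (Set.range (MvPolynomial.X (R := K) (σ := σ))) := by
  have h : Ideal.span (Set.range (MvPolynomial.X (R := K) (σ := σ))) ≤
      RingHom.ker (MvPolynomial.constantCoeff (R := K) (σ := σ)) := by
    rw [Ideal.span_le]
    rintro _ ⟨i, rfl⟩
    simp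
  intro h1
  simpa using h h1

lemma coeffRank_residueModule : coeffRank (residueModule σ K) = 1 := by
  let v : (ModuleCat.restrictScalars (algebraMap K (MvPolynomial σ K))).obj (residueModule σ K) :=
    Ideal.Quotient.mk (Ideal.span (Set.range (MvPolynomial.X (R := K) (σ := σ)))) 1
  refine rank_eq_one v (fun h => one_notMem_span_range_X (Ideal.Quotient.eq_zero_iff_mem.1 h)) ?_
  intro w
  obtain ⟨p, rfl⟩ := Ideal.Quotient.mk_surjective w
  refine ⟨MvPolynomial.constantCoeff p, (Ideal.Quotient.eq.2 ?_).symm⟩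
  simpa using sub_C_constantCoeff_mem p

lemma bettiNumber_self_zero :
    bettiNumber (ModuleCat.of (MvPolynomial σ K) (MvPolynomial σ K)) 0 = 1 := by
  let F := (MonoidalCategory.tensoringLeft _).obj (residueModule σ K)
  have : Projective (ModuleCat.of (MvPolynomial σ K) (MvPolynomial σ K)) :=
    ModuleCat.projective_of_free (Module.Basis.singleton Unit (MvPolynomial σ K))
  rw [← coeffRank_residueModule (σ := σ) (K := K)]
  exact coeffRank_eq_of_iso ((F.leftDerivedZeroIsoOfProjective _) ≪≫
    MonoidalCategory.rightUnitor (residueModule σ K))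

lemma bettiNumber_succ_of_projective (M : ModuleCat.{max v u} (MvPolynomial σ K)) [Projective M]
    (j : ℕ) : bettiNumber M (j + 1) = 0 :=
  coeffRank_eq_zero (isZero_Tor_succ_of_projective _ _ M j)

end Betti

end

/-! ### The exact sequence of `y J + x I` -/

section Ideals

variable {R : Type u} [CommRing R] [IsDomain R] {I J L : Ideal R} {x y : R}

/-- For ideals `I ≤ J` and `L = y J + x I`, the complex `I ⟶ J × I ⟶ L` given by
`a ↦ (x a, - y a)` and `(b, c) ↦ y b + x c`. -/
noncomputable def Ideal.mulAddComplex (hIJ : I ≤ J)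
    (hL : L = Ideal.span {y} * J ⊔ Ideal.span {x} * I) : ShortComplex (ModuleCat.{u} R) :=
  ShortComplex.mk (X₁ := ModuleCat.of R I) (X₂ := ModuleCat.of R (J × I)) (X₃ := ModuleCat.of R L)
    (x • ModuleCat.ofHom ((Submodule.inclusion hIJ).prod 0) +
      y • ModuleCat.ofHom ((0 : I →ₗ[R] J).prod (-LinearMap.id)))
    (ModuleCat.ofHom (LinearMap.codRestrict L
      (y • J.subtype ∘ₗ LinearMap.fst R J I + x • I.subtype ∘ₗ LinearMap.snd R J I) (by
        rintro ⟨b, c⟩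
        rw [hL]
        exact Submodule.add_mem_sup
          (Ideal.mul_mem_mul (Ideal.mem_span_singleton_self y) b.2)
          (Ideal.mul_mem_mul (Ideal.mem_span_singleton_self x) c.2))))
    (by
      ext a
      change y * (x * (a : R) + y * 0) + x * (x * 0 + y * -(a : R)) = 0
      ring)

/-- A relation `y b + x c = 0` forces `c = y a` since `x` is regular modulo `y`; then `a ∈ I` since
`y` is regular modulo `I`, and cancelling `y` gives `b = -x a`. -/
lemma Ideal.shortExact_mulAddComplex (hIJ : I ≤ J)
    (hL : L = Ideal.span {y} * J ⊔ Ideal.span {x} * I) (hy : y ≠ 0)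
    (hxy : ∀ c, y ∣ x * c → y ∣ c) (hI : ∀ a, y * a ∈ I → a ∈ I) :
    (Ideal.mulAddComplex hIJ hL).ShortExact := by
  apply ShortComplex.ShortExact.mk'
  · rw [ShortComplex.moduleCat_exact_iff]
    rintro ⟨⟨b, hb⟩, ⟨c, hc⟩⟩ h
    have h' : y * b + x * c = 0 := congrArg Subtype.val h
    obtain ⟨a, rfl⟩ := hxy c ⟨-b, by linear_combination h'⟩
    have hb' : b = -(x * a) := mul_left_cancel₀ hy (by linear_combination h')
    refine ⟨⟨-a, neg_mem (hI a hc)⟩, ?_⟩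
    apply Prod.ext <;> apply Subtype.ext
    · change x * (-a) + y * 0 = b
      rw [hb']; ring
    · change x * 0 + y * (- -a) = y * a
      ring
  · rw [ModuleCat.mono_iff_injective]
    rintro (a : I) (a' : I) h
    have h' : x * 0 + y * (-(a : R)) = x * 0 + y * (-(a' : R)) :=
      congrArg (fun z : J × I => (z.2 : R)) h
    apply Subtype.ext
    exact mul_left_cancel₀ hy (by linear_combination -h')
  · rw [ModuleCat.epi_iff_surjective]
    rintro ⟨z, hz⟩
    have hz' := hz
    rw [hL, Submodule.mem_sup] at hz'
    obtain ⟨p, hp, q, hq, rfl⟩ := hz'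
    obtain ⟨b, hb, rfl⟩ := Ideal.mem_span_singleton_mul.1 hp
    obtain ⟨c, hc, rfl⟩ := Ideal.mem_span_singleton_mul.1 hq
    exact ⟨(⟨b, hb⟩, ⟨c, hc⟩), rfl⟩

end Ideals

/-- The binary product of modules as a split short complex. -/
noncomputable def ModuleCat.prodSplitting {R : Type u} [CommRing R] (M N : ModuleCat.{u} R) :
    (ShortComplex.mk (X₁ := M) (X₂ := ModuleCat.of R (M × N)) (X₃ := N)
      (ModuleCat.ofHom (LinearMap.inl R M N)) (ModuleCat.ofHom (LinearMap.snd R M N))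
      (by ext; simp)).Splitting where
  r := ModuleCat.ofHom (LinearMap.fst R M N)
  s := ModuleCat.ofHom (LinearMap.inr R M N)


/-! ### Monomial ideals not involving a variable -/

section Monomial

open MvPolynomial

variable {σ : Type*} {K : Type*} [Field K]

/-- Membership in a monomial ideal is tested on each monomial of the support, and raising the
exponent of a variable absent from the generators does not affect divisibility by them. -/
lemma mem_span_monomial_of_X_mul_mem {s : Set (σ →₀ ℕ)} {i : σ} (hs : ∀ e ∈ s, e i = 0)
    {a : MvPolynomial σ K} (h : X i * a ∈ Ideal.span ((fun e => monomial e (1 : K)) '' s)) :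
    a ∈ Ideal.span ((fun e => monomial e (1 : K)) '' s) := by
  classical
  rw [mem_ideal_span_monomial_image] at h ⊢
  intro m hm
  obtain ⟨e, he, hle⟩ := h (Finsupp.single i 1 + m) (by
    rw [mem_support_iff, coeff_X_mul]; exact mem_support_iff.1 hm)
  refine ⟨e, he, fun j => ?_⟩
  by_cases hj : i = j
  · subst hj; rw [hs e he]; exact Nat.zero_le _
  · simpa [Finsupp.single_apply, hj] using hle j

lemma X_dvd_of_dvd_X_mul {i j : σ} (hij : i ≠ j) {c : MvPolynomial σ K}
    (h : X j ∣ X i * c) : X j ∣ c := by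
  refine ((MvPolynomial.X_prime (i := j)).dvd_or_dvd h).resolve_left fun h' => hij ?_
  exact (X_dvd_X.1 h').symm

end Monomial

/-! ### Face ideals over a variable vertex set: deletion and link -/

section RelativeFaceIdeal

open MvPolynomial

variable {ι : Type v} [DecidableEq ι] (K : Type u) [Field K]

/-- The monomial `∏_{i ∈ F} x_i ∏_{i ∈ A \ F} y_i`. -/
noncomputable def relFaceMonomial (A F : Finset ι) : MvPolynomial (ι ⊕ ι) K :=
  (∏ i ∈ F, X (Sum.inl i)) * ∏ i ∈ A \ F, X (Sum.inr i)

/-- The exponent of `relFaceMonomial`. -/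
noncomputable def relFaceExponent (A F : Finset ι) : ι ⊕ ι →₀ ℕ :=
  (∑ i ∈ F, Finsupp.single (Sum.inl i) 1) + ∑ i ∈ A \ F, Finsupp.single (Sum.inr i) 1

lemma relFaceMonomial_eq (A F : Finset ι) :
    relFaceMonomial K A F = monomial (relFaceExponent A F) 1 := by
  simp only [relFaceMonomial, relFaceExponent, X]
  rw [← monomial_sum_one, ← monomial_sum_one, monomial_mul, one_mul]

/-- The ideal generated by the monomials `∏_{i ∈ F} x_i ∏_{i ∈ A \ F} y_i` with `F ∈ T`. -/
noncomputable def relFaceIdeal (A : Finset ι) (T : Finset (Finset ι)) :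
    Ideal (MvPolynomial (ι ⊕ ι) K) :=
  Ideal.span (relFaceMonomial K A '' (T : Set (Finset ι)))

lemma relFaceMonomial_insert {A F : Finset ι} {v : ι} (hA : v ∉ A) (hF : v ∉ F) :
    relFaceMonomial K (insert v A) F = X (Sum.inr v) * relFaceMonomial K A F := by
  rw [relFaceMonomial, relFaceMonomial, Finset.insert_sdiff_of_notMem _ hF,
    Finset.prod_insert (by simp [hA])]
  ring

lemma relFaceMonomial_insert_insert {A F : Finset ι} {v : ι} (hA : v ∉ A) (hF : v ∉ F) :
    relFaceMonomial K (insert v A) (insert v F) = X (Sum.inl v) * relFaceMonomial K A F := by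
  have h : insert v A \ insert v F = A \ F := by
    ext i; simp only [Finset.mem_sdiff, Finset.mem_insert]
    grind
  rw [relFaceMonomial, relFaceMonomial, h, Finset.prod_insert hF]
  ring

/-- Faces avoiding `v` (the deletion) contribute a factor `y_v`; faces containing `v` contribute
`x_v` and correspond to the link. -/
lemma relFaceIdeal_insert {A : Finset ι} {v : ι} (hA : v ∉ A) (T : Finset (Finset ι)) :
    relFaceIdeal K (insert v A) T =
      Ideal.span {X (Sum.inr v)} * relFaceIdeal K A (T.nonMemberSubfamily v) ⊔
      Ideal.span {X (Sum.inl v)} * relFaceIdeal K A (T.memberSubfamily v) := by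
  simp only [relFaceIdeal, Ideal.span_mul_span', Set.singleton_mul, ← Ideal.span_union]
  congr 1
  ext p
  simp only [Set.mem_image, Set.mem_union, Finset.mem_coe, Finset.mem_nonMemberSubfamily,
    Finset.mem_memberSubfamily, exists_exists_and_eq_and]
  constructor
  · rintro ⟨F, hF, rfl⟩
    by_cases hv : v ∈ F
    · refine Or.inr ⟨F.erase v, ⟨by rwa [Finset.insert_erase hv], by simp⟩, ?_⟩
      rw [← relFaceMonomial_insert_insert K hA (by simp), Finset.insert_erase hv]
    · exact Or.inl ⟨F, ⟨hF, hv⟩, (relFaceMonomial_insert K hA hv).symm⟩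
  · rintro (⟨F, ⟨hF, hv⟩, rfl⟩ | ⟨F, ⟨hF, hv⟩, rfl⟩)
    · exact ⟨F, hF, relFaceMonomial_insert K hA hv⟩
    · exact ⟨_, hF, relFaceMonomial_insert_insert K hA hv⟩

lemma relFaceIdeal_mono {A : Finset ι} {T T' : Finset (Finset ι)} (h : T ⊆ T') :
    relFaceIdeal K A T ≤ relFaceIdeal K A T' :=
  Ideal.span_mono (Set.image_mono (by exact_mod_cast h))

lemma mem_relFaceIdeal_of_X_mul_mem {A : Finset ι} {v : ι} (hA : v ∉ A) (T : Finset (Finset ι))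
    {a : MvPolynomial (ι ⊕ ι) K} (h : X (Sum.inr v) * a ∈ relFaceIdeal K A T) :
    a ∈ relFaceIdeal K A T := by
  have e : relFaceMonomial K A '' (T : Set (Finset ι)) =
      (fun e => monomial e (1 : K)) '' (relFaceExponent A '' (T : Set (Finset ι))) := by
    rw [Set.image_image]
    simp only [relFaceMonomial_eq]
  rw [relFaceIdeal, e] at h ⊢
  refine mem_span_monomial_of_X_mul_mem ?_ h
  rintro _ ⟨F, -, rfl⟩
  simp only [relFaceExponent, Finsupp.add_apply, Finsupp.finsetSum_apply]
  have : ∀ i ∈ A \ F, i ≠ v := fun i hi hv => hA (hv ▸ (Finset.mem_sdiff.1 hi).1)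
  rw [Finset.sum_eq_zero (by simp), Finset.sum_eq_zero (fun i hi => by simp [this i hi]),
    add_zero]

lemma memberSubfamily_subset_nonMemberSubfamily {T : Finset (Finset ι)}
    (hT : ∀ F ∈ T, ∀ G, G ⊆ F → G ∈ T) (v : ι) :
    T.memberSubfamily v ⊆ T.nonMemberSubfamily v := by
  intro F
  simp only [Finset.mem_memberSubfamily, Finset.mem_nonMemberSubfamily]
  exact fun ⟨h, hv⟩ => ⟨hT _ h _ (Finset.subset_insert _ _), hv⟩

lemma sum_eq_sum_nonMemberSubfamily_add {M : Type*} [AddCommMonoid M] (T : Finset (Finset ι))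
    (v : ι) (g : Finset ι → M) :
    ∑ F ∈ T, g F = ∑ F ∈ T.nonMemberSubfamily v, g F +
      ∑ F ∈ T.memberSubfamily v, g (insert v F) := by
  rw [← Finset.sum_filter_not_add_sum_filter T (fun F => v ∈ F), Finset.nonMemberSubfamily]
  congr 1
  refine (Finset.sum_bij (fun F _ => insert v F) ?_ ?_ ?_ ?_).symm
  · intro F hF
    simpa using (Finset.mem_memberSubfamily.1 hF).1
  · intro F hF G hG h
    rw [← Finset.erase_insert (Finset.mem_memberSubfamily.1 hF).2, h,
      Finset.erase_insert (Finset.mem_memberSubfamily.1 hG).2]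
  · intro F hF
    obtain ⟨hF, hv⟩ := Finset.mem_filter.1 hF
    exact ⟨F.erase v, Finset.mem_memberSubfamily.2 ⟨by rwa [Finset.insert_erase hv], by simp⟩,
      Finset.insert_erase hv⟩
  · intro F _; rfl

end RelativeFaceIdeal

lemma bettiNumber_prod {σ : Type v} {K : Type u} [Field K]
    (M N : ModuleCat.{max v u} (MvPolynomial σ K)) (j : ℕ) :
    bettiNumber (ModuleCat.of (MvPolynomial σ K) (M × N)) j = bettiNumber M j + bettiNumber N j :=
  bettiNumber_add_of_splitting (ModuleCat.prodSplitting M N) j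

lemma hasProjectiveDimensionLT_prod {R : Type u} [CommRing R] (M N : ModuleCat.{u} R) (m : ℕ)
    (hM : HasProjectiveDimensionLT M m) (hN : HasProjectiveDimensionLT N m) :
    HasProjectiveDimensionLT (ModuleCat.of R (M × N)) m :=
  (ModuleCat.prodSplitting M N).shortExact.hasProjectiveDimensionLT_X₂ m hM hN

/-! ### Induction on the vertex set -/

section RelativeFaceIdeal

open MvPolynomial Limits

variable {ι : Type v} [DecidableEq ι] (K : Type u) [Field K]

/-- The module underlying `relFaceIdeal`. -/
noncomputable abbrev relFaceModule (A : Finset ι) (T : Finset (Finset ι)) :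
    ModuleCat.{max v u} (MvPolynomial (ι ⊕ ι) K) :=
  ModuleCat.of _ (relFaceIdeal K A T)

lemma isZero_relFaceModule_empty (A : Finset ι) : IsZero (relFaceModule K A ∅) := by
  have : relFaceIdeal K A ∅ = ⊥ := by simp [relFaceIdeal]
  rw [relFaceModule, this]
  exact ModuleCat.isZero_of_subsingleton _

/-- The ideal generated by the empty monomial is free of rank one. -/
noncomputable def relFaceModuleEmptyIso :
    relFaceModule K (∅ : Finset ι) {∅} ≅ ModuleCat.of _ (MvPolynomial (ι ⊕ ι) K) :=
  (LinearEquiv.ofTop _ (by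
    simp [relFaceIdeal, relFaceMonomial, Ideal.span_singleton_one])).toModuleIso

lemma eq_empty_or_eq_singleton_of_forall_subset_empty {α : Type*} {T : Finset (Finset α)}
    (hA : ∀ F ∈ T, F ⊆ ∅) : T = ∅ ∨ T = {∅} :=
  Finset.subset_singleton_iff.1 fun F hF =>
    Finset.mem_singleton.2 (Finset.subset_empty.1 (hA F hF))

section Step

variable {A : Finset ι} {v : ι} (hA : v ∉ A) {T : Finset (Finset ι)}
  (hT : ∀ F ∈ T, ∀ G, G ⊆ F → G ∈ T)

/-- The short complex relating the ideal of `T` to those of the deletion and link of `v`. -/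
noncomputable def vertexComplex : ShortComplex (ModuleCat.{max v u} (MvPolynomial (ι ⊕ ι) K)) :=
  Ideal.mulAddComplex (relFaceIdeal_mono K (memberSubfamily_subset_nonMemberSubfamily hT v))
    (relFaceIdeal_insert K hA T)

lemma shortExact_vertexComplex : (vertexComplex K hA hT).ShortExact :=
  Ideal.shortExact_mulAddComplex _ _ (X_ne_zero _)
    (fun _ h => X_dvd_of_dvd_X_mul (by simp) h)
    (fun _ h => mem_relFaceIdeal_of_X_mul_mem K hA _ h)

lemma tor_map_vertexComplex_f (j : ℕ) :
    ((Tor _ j).obj (residueModule (ι ⊕ ι) K)).map (vertexComplex K hA hT).f = 0 := by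
  have (s : ι ⊕ ι) {M N : ModuleCat.{max v u} (MvPolynomial (ι ⊕ ι) K)} (f : M ⟶ N) :=
    ModuleCat.tor_map_smul (X_smul_residueModule s) f j
  exact (Functor.map_add (F := Functor.leftDerived
    ((MonoidalCategory.tensoringLeft _).obj (residueModule (ι ⊕ ι) K)) j)).trans
    ((congrArg₂ (· + ·) (this _ _) (this _ _)).trans (add_zero _))

lemma bettiNumber_vertexComplex_X₂ (j : ℕ) :
    bettiNumber (vertexComplex K hA hT).X₂ j =
      bettiNumber (relFaceModule K A (T.nonMemberSubfamily v)) j +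
        bettiNumber (relFaceModule K A (T.memberSubfamily v)) j :=
  bettiNumber_prod (relFaceModule K A (T.nonMemberSubfamily v))
    (relFaceModule K A (T.memberSubfamily v)) j

end Step

lemma down_closed_memberSubfamily {T : Finset (Finset ι)} (hT : ∀ F ∈ T, ∀ G, G ⊆ F → G ∈ T)
    (v : ι) : ∀ F ∈ T.memberSubfamily v, ∀ G, G ⊆ F → G ∈ T.memberSubfamily v := by
  intro F hF G hG
  rw [Finset.mem_memberSubfamily] at hF ⊢
  exact ⟨hT _ hF.1 _ (Finset.insert_subset_insert v hG), fun h => hF.2 (hG h)⟩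

lemma down_closed_nonMemberSubfamily {T : Finset (Finset ι)} (hT : ∀ F ∈ T, ∀ G, G ⊆ F → G ∈ T)
    (v : ι) : ∀ F ∈ T.nonMemberSubfamily v, ∀ G, G ⊆ F → G ∈ T.nonMemberSubfamily v := by
  intro F hF G hG
  rw [Finset.mem_nonMemberSubfamily] at hF ⊢
  exact ⟨hT _ hF.1 _ hG, fun h => hF.2 (hG h)⟩

lemma subset_of_mem_nonMemberSubfamily {A : Finset ι} {v : ι} {T : Finset (Finset ι)}
    (hTA : ∀ F ∈ T, F ⊆ insert v A) : ∀ F ∈ T.nonMemberSubfamily v, F ⊆ A := by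
  intro F hF
  rw [Finset.mem_nonMemberSubfamily] at hF
  exact (Finset.subset_insert_iff_of_notMem hF.2).1 (hTA F hF.1)

/-- The family `T` may be empty: the link of `v` has no faces when `{v}` is not a face, so the
induction must include the zero ideal. -/
theorem bettiNumber_relFaceModule (A : Finset ι) (T : Finset (Finset ι))
    (hTA : ∀ F ∈ T, F ⊆ A) (hT : ∀ F ∈ T, ∀ G, G ⊆ F → G ∈ T) (j : ℕ) :
    bettiNumber (relFaceModule K A T) j = ((∑ F ∈ T, F.card.choose j : ℕ) : Cardinal) := by
  induction A using Finset.induction_on generalizing T j with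
  | empty =>
    obtain rfl | rfl := eq_empty_or_eq_singleton_of_forall_subset_empty hTA
    · have : HasProjectiveDimensionLT (relFaceModule K (∅ : Finset ι) ∅) j :=
        have := (isZero_relFaceModule_empty K (∅ : Finset ι)).hasProjectiveDimensionLT_zero
        hasProjectiveDimensionLT_of_ge _ 0 j (Nat.zero_le _)
      simpa using bettiNumber_eq_zero_of_hasProjectiveDimensionLT _ j
    · rw [bettiNumber_eq_of_iso (relFaceModuleEmptyIso K)]
      cases j with
      | zero => simpa using bettiNumber_self_zero
      | succ j =>
        have : Projective (ModuleCat.of _ (MvPolynomial (ι ⊕ ι) K)) :=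
          ModuleCat.projective_of_free (Module.Basis.singleton Unit (MvPolynomial (ι ⊕ ι) K))
        simpa using bettiNumber_succ_of_projective _ j
  | insert v A hA ih =>
    have hS := shortExact_vertexComplex K hA hT
    have hf := tor_map_vertexComplex_f K hA hT
    have hd := ih _ (subset_of_mem_nonMemberSubfamily hTA) (down_closed_nonMemberSubfamily hT v)
    have hl := ih _ (fun F hF => subset_of_mem_nonMemberSubfamily hTA F
      (memberSubfamily_subset_nonMemberSubfamily hT v hF)) (down_closed_memberSubfamily hT v)
    have hcard : ∀ F ∈ T.memberSubfamily v, (insert v F).card = F.card + 1 := fun F hF =>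
      Finset.card_insert_of_notMem (Finset.mem_memberSubfamily.1 hF).2
    rw [sum_eq_sum_nonMemberSubfamily_add T v,
      Finset.sum_congr (s₁ := T.memberSubfamily v) (g := fun F => (F.card + 1).choose j) rfl
        (fun F hF => by rw [hcard F hF])]
    have h₂ := bettiNumber_vertexComplex_X₂ K hA hT j
    rw [hd, hl] at h₂
    cases j with
    | zero =>
      refine (bettiNumber_zero_of_tor_map_eq_zero hS hf).trans (h₂.trans ?_)
      simp
    | succ j =>
      refine (bettiNumber_succ_of_tor_map_eq_zero hS hf j).trans ?_
      rw [h₂]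
      refine (congrArg _ (hl j)).trans ?_
      -- Pascal's rule splits the link sum into its contributions in degrees `j` and `j + 1`.
      simp only [Nat.choose_succ_succ', Finset.sum_add_distrib]
      push_cast
      ring

/-- Link faces gain `v` in `T`, so they satisfy the bound with `m` lowered by one. This is exactly
what the left term of the short exact sequence needs. -/
theorem hasProjectiveDimensionLT_relFaceModule (A : Finset ι) (T : Finset (Finset ι))
    (hTA : ∀ F ∈ T, F ⊆ A) (hT : ∀ F ∈ T, ∀ G, G ⊆ F → G ∈ T) (m : ℕ)
    (hm : ∀ F ∈ T, F.card < m) : HasProjectiveDimensionLT (relFaceModule K A T) m := by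
  have h0 (A : Finset ι) (m : ℕ) : HasProjectiveDimensionLT (relFaceModule K A ∅) m :=
    have := (isZero_relFaceModule_empty K A).hasProjectiveDimensionLT_zero
    hasProjectiveDimensionLT_of_ge _ 0 m (Nat.zero_le _)
  induction A using Finset.induction_on generalizing T m with
  | empty =>
    obtain rfl | rfl := eq_empty_or_eq_singleton_of_forall_subset_empty hTA
    · exact h0 _ _
    · have : Projective (ModuleCat.of _ (MvPolynomial (ι ⊕ ι) K)) :=
        ModuleCat.projective_of_free (Module.Basis.singleton Unit (MvPolynomial (ι ⊕ ι) K))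
      have : HasProjectiveDimensionLT (relFaceModule K (∅ : Finset ι) {∅}) 1 :=
        hasProjectiveDimensionLT_of_iso (relFaceModuleEmptyIso K).symm 1
      exact hasProjectiveDimensionLT_of_ge _ 1 m (hm ∅ (Finset.mem_singleton_self _))
  | insert v A hA ih =>
    obtain _ | m := m
    · obtain rfl : T = ∅ := Finset.eq_empty_of_forall_notMem fun F hF => by simpa using hm F hF
      exact h0 _ _
    have hd := ih _ (subset_of_mem_nonMemberSubfamily hTA) (down_closed_nonMemberSubfamily hT v)
      (m + 1) (fun F hF => hm F (Finset.mem_nonMemberSubfamily.1 hF).1)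
    have hl := ih _ (fun F hF => subset_of_mem_nonMemberSubfamily hTA F
      (memberSubfamily_subset_nonMemberSubfamily hT v hF)) (down_closed_memberSubfamily hT v)
      m (fun F hF => by
        have := hm _ (Finset.mem_memberSubfamily.1 hF).1
        rw [Finset.card_insert_of_notMem (Finset.mem_memberSubfamily.1 hF).2] at this
        omega)
    exact (shortExact_vertexComplex K hA hT).hasProjectiveDimensionLT_X₃ m hl
      (hasProjectiveDimensionLT_prod _ (relFaceModule K A (T.memberSubfamily v)) (m + 1) hd
        (hasProjectiveDimensionLT_of_ge _ m (m + 1) (Nat.le_succ m)))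

end RelativeFaceIdeal

/-! ### The `f`-vector and the conclusion -/

namespace FiniteSimplicialComplex

variable {n : ℕ} (Δ : FiniteSimplicialComplex n)

lemma relFaceIdeal_univ (K : Type*) [Field K] :
    relFaceIdeal K Finset.univ Δ.faces = Δ.faceIdeal K := by
  have (F : Finset (Fin n)) : relFaceMonomial K Finset.univ F = faceMonomial K F := by
    rw [relFaceMonomial, faceMonomial, Finset.compl_eq_univ_sdiff]
  rw [relFaceIdeal, faceIdeal]
  exact congrArg Ideal.span (Set.image_congr fun F _ => this F)

lemma card_le_of_dim_eq {d : ℕ} (hd : Δ.dim = (d : ℤ) - 1) {F : Finset (Fin n)}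
    (hF : F ∈ Δ.faces) : F.card ≤ d := by
  have h : (F.card : ℤ) - 1 ≤ Δ.dim := Finset.le_sup' (fun F => (F.card : ℤ) - 1) hF
  omega

lemma exists_card_eq_of_dim_eq {d : ℕ} (hd : Δ.dim = (d : ℤ) - 1) :
    ∃ F ∈ Δ.faces, F.card = d := by
  obtain ⟨F, hF, h⟩ := Finset.exists_mem_eq_sup' ⟨∅, Δ.empty_mem⟩ fun F : Finset (Fin n) =>
    (F.card : ℤ) - 1
  refine ⟨F, hF, ?_⟩
  rw [dim] at hd
  omega

lemma sum_choose_mul_fVec {d : ℕ} (hd : Δ.dim = (d : ℤ) - 1) (j : ℕ) :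
    ∑ i ∈ Finset.Icc (-1 : ℤ) ((d : ℤ) - 1), Nat.choose (i + 1).toNat j * Δ.fVec i =
      ∑ F ∈ Δ.faces, F.card.choose j := by
  rw [← Finset.sum_fiberwise_of_maps_to (s := Δ.faces)
    (t := Finset.Icc (-1 : ℤ) ((d : ℤ) - 1)) (g := fun F => (F.card : ℤ) - 1)
    (fun F hF => by
      have := Δ.card_le_of_dim_eq hd hF
      rw [Finset.mem_Icc]; omega)]
  refine Finset.sum_congr rfl fun i _ => ?_
  rw [Finset.sum_congr (g := fun _ => (i + 1).toNat.choose j) rfl, Finset.sum_const, fVec,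
    smul_eq_mul, mul_comm]
  intro F hF
  rw [← (Finset.mem_filter.1 hF).2]
  simp

end FiniteSimplicialComplex

theorem corollary1p4 (K : Type u) [Field K] (n d : ℕ) (Δ : FiniteSimplicialComplex n)
    (hd : Δ.dim = (d : ℤ) - 1) :
    (∀ j : ℕ, bettiNumber (ModuleCat.of (MvPolynomial (Fin n ⊕ Fin n) K) (Δ.faceIdeal K)) j =
      ((∑ i ∈ Finset.Icc (-1 : ℤ) ((d : ℤ) - 1),
        Nat.choose (i + 1).toNat j * Δ.fVec i : ℕ) : Cardinal)) ∧
    ∃ p : ℕ,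
      projectiveDimension
        (ModuleCat.of (MvPolynomial (Fin n ⊕ Fin n) K) (Δ.faceIdeal K)) = (p : WithBot ℕ∞) ∧
      (p : ℤ) = Δ.dim + 1 := by
  have hβ (j : ℕ) : bettiNumber (ModuleCat.of (MvPolynomial (Fin n ⊕ Fin n) K) (Δ.faceIdeal K)) j =
      ((∑ F ∈ Δ.faces, F.card.choose j : ℕ) : Cardinal) := by
    rw [← Δ.relFaceIdeal_univ K]
    exact bettiNumber_relFaceModule K Finset.univ Δ.faces (fun F _ => Finset.subset_univ F)
      Δ.down_closed j
  refine ⟨fun j => by rw [hβ, Δ.sum_choose_mul_fVec hd], d, le_antisymm ?_ ?_, by omega⟩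
  · rw [projectiveDimension_le_iff, ← Δ.relFaceIdeal_univ K]
    exact hasProjectiveDimensionLT_relFaceModule K Finset.univ Δ.faces
      (fun F _ => Finset.subset_univ F) Δ.down_closed (d + 1)
      (fun F hF => Nat.lt_succ_of_le (Δ.card_le_of_dim_eq hd hF))
  · rw [projectiveDimension_ge_iff]
    intro h
    obtain ⟨F, hF, hFd⟩ := Δ.exists_card_eq_of_dim_eq hd
    have h0 := (hβ d).symm.trans (bettiNumber_eq_zero_of_hasProjectiveDimensionLT _ d)
    -- A vanishing sum of naturals has only zero terms, but the face `F` of size `d` contributes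
    -- `d.choose d = 1`.
    rw [Nat.cast_eq_zero, Finset.sum_eq_zero_iff] at h0
    simpa [hFd] using h0 F hF
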